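/- Let $\sigma$ be a probability measure on $\mathbb{R}$ with $\sigma([0,1])=1$. For $0<\varepsilon<1$ put $$\sigma^t_\varepsilon:=\sigma-\sum_{\{x\,:\,\sigma(\{x\})>\varepsilon\}}(\sigma(\{x\})-\varepsilon)\,\delta_x,\qquad \sigma'_\varepsilon:=\frac{\sigma^t_\varepsilon}{\sigma^t_\varepsilon(\mathbb{R})},$$ that is, $\sigma$ with all its atoms truncated to mass $\varepsilon$, and its normalization. For a probability measure $\mu$ on $\mathbb{R}$ and $0<\delta<1$ let $$R_\mu(\delta):=\min\{|x-y| : x,y\in\mathbb{R},\ \mu([x,y])\ge\delta\}.$$ Fix an integer $k\ge 2$ and suppose that $0<\varepsilon<1$ satisfies $$\frac{\varepsilon}{\sigma^t_\varepsilon([0,1])}<\frac{2}{2k+7}.$$ Let $$\rho:=(k-1)\,R_{\sigma'_\varepsilon}\!\left(\frac{2}{2k+7}\right),\qquad r:=\frac{\rho}{6(k+3)}\left(\frac{\rho}{12e}\right)^{k-1}.$$ Then for every integer $$n\ge\max\left(\frac{1}{r\,\sigma^t_\varepsilon([0,1])},\ \frac{2k+6}{\varepsilon}\right)$$ there exist (not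 necessarily distinct) $x_1,\dots,x_n\in[0,1]$ such that $$\frac1n\sum_{i=1}^n x_i^j=\int x^j\,d\sigma(x)\qquad\text{for all integers } 1\le j\le k.$$ -/

import Mathlib

open MeasureTheory Set

/-- The inverse modulus of continuity of a measure `σ` on the line:
`R_σ(δ) = min { |x - y| : σ([x, y]) ≥ δ }`, the minimal length of an interval of mass at least
`δ`. For a probability measure and `0 < δ < 1` the minimum is attained, see
`inverseModulus_isLeast`. -/
noncomputable def inverseModulus (σ : Measure ℝ) (δ : ℝ) : ℝ :=
  sInf {l : ℝ | ∃ x y : ℝ, ENNReal.ofReal δ ≤ σ (Icc x y) ∧ l = |x - y|}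

/-- `σ` with all its atoms truncated to mass `ε`:
`σ - ∑_{x : σ({x}) > ε} (σ({x}) - ε) δ_x`. -/
noncomputable def truncateAtoms (σ : Measure ℝ) (ε : ℝ) : Measure ℝ :=
  σ - Measure.sum (fun x : {x : ℝ // ENNReal.ofReal ε < σ {x}} =>
    (σ {(x : ℝ)} - ENNReal.ofReal ε) • Measure.dirac (x : ℝ))

/-- The normalization of `truncateAtoms σ ε` to total mass one. -/
noncomputable def normalizedTruncation (σ : Measure ℝ) (ε : ℝ) : Measure ℝ :=
  (truncateAtoms σ ε univ)⁻¹ • truncateAtoms σ ε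

/-- The infimum in the definition of `inverseModulus` is a minimum. -/
theorem inverseModulus_isLeast (σ : Measure ℝ) [IsProbabilityMeasure σ] (δ : ℝ)
    (h0 : 0 < δ) (h1 : δ < 1) :
    IsLeast {l : ℝ | ∃ x y : ℝ, ENNReal.ofReal δ ≤ σ (Icc x y) ∧ l = |x - y|}
      (inverseModulus σ δ) := by
  have hδ1 : ENNReal.ofReal δ < 1 := by
    rw [← ENNReal.ofReal_one]; exact (ENNReal.ofReal_lt_ofReal_iff one_pos).2 h1
  have hlim : Filter.Tendsto (fun N : ℕ => σ (Icc (-(N : ℝ)) N)) Filter.atTop (nhds 1) := by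
    have hm : Monotone (fun N : ℕ => Icc (-(N : ℝ)) (N : ℝ)) := by
      intro a b hab
      have : (a : ℝ) ≤ b := by exact_mod_cast hab
      exact Icc_subset_Icc (by linarith) this
    have h := tendsto_measure_iUnion_atTop (μ := σ) hm
    have hU : (⋃ N : ℕ, Icc (-(N : ℝ)) (N : ℝ)) = univ := by
      refine eq_univ_of_forall fun x => mem_iUnion.2 ?_
      obtain ⟨N, hN⟩ := exists_nat_ge |x|
      exact ⟨N, abs_le.1 hN⟩
    rw [hU, measure_univ] at h
    exact h
  -- a central interval meeting every interval of mass at least `δ`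
  obtain ⟨N, hN⟩ : ∃ N : ℕ, max (ENNReal.ofReal δ) (1 - ENNReal.ofReal δ)
      < σ (Icc (-(N : ℝ)) N) := by
    refine ((hlim.eventually (lt_mem_nhds ?_))).exists
    refine max_lt hδ1 (ENNReal.sub_lt_self ENNReal.one_ne_top one_ne_zero ?_)
    simpa using h0
  have hN1 := lt_of_le_of_lt (le_max_left _ _) hN
  have hN2 := lt_of_le_of_lt (le_max_right _ _) hN
  have hmeet : ∀ x y : ℝ, ENNReal.ofReal δ ≤ σ (Icc x y) →
      x ≤ y ∧ x ≤ N ∧ -(N : ℝ) ≤ y := by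
    intro x y hxy
    have hne : (Icc x y ∩ Icc (-(N : ℝ)) N).Nonempty := by
      rw [← not_disjoint_iff_nonempty_inter]
      intro hd
      have h2 := measure_union hd (measurableSet_Icc (a := -(N : ℝ)) (b := N)) (μ := σ)
      have h3 : σ (Icc x y ∪ Icc (-(N : ℝ)) N) ≤ 1 := prob_le_one
      rw [h2] at h3
      have h4 : σ (Icc (-(N : ℝ)) N) ≤ 1 - ENNReal.ofReal δ :=
        ENNReal.le_sub_of_add_le_left ENNReal.ofReal_ne_top
          ((add_le_add_left hxy _).trans h3)
      exact absurd hN2 (not_lt.2 h4)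
    obtain ⟨z, ⟨hz1, hz2⟩, hz3, hz4⟩ := hne
    exact ⟨hz1.trans hz2, hz1.trans hz4, hz3.trans hz2⟩
  have hclosed : IsClosed {p : ℝ × ℝ | ENNReal.ofReal δ ≤ σ (Icc p.1 p.2)} := by
    refine isClosed_of_closure_subset fun p hp => ?_
    have hthick : Filter.Tendsto (fun η : ℝ => σ (Icc (p.1 - η) (p.2 + η)))
        (nhdsWithin 0 (Ioi 0)) (nhds (σ (Icc p.1 p.2))) := by
      have hI : (⋂ η : ℝ, ⋂ _ : η > 0, Icc (p.1 - η) (p.2 + η)) = Icc p.1 p.2 := by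
        ext z
        simp only [mem_iInter, mem_Icc]
        constructor
        · intro h
          exact ⟨le_of_forall_pos_le_add fun η hη => by linarith [(h η hη).1],
            le_of_forall_pos_le_add fun η hη => (h η hη).2⟩
        · rintro ⟨ha, hb⟩ η hη
          exact ⟨by linarith, by linarith⟩
      have h := tendsto_measure_biInter_gt (μ := σ)
        (s := fun η : ℝ => Icc (p.1 - η) (p.2 + η)) (a := 0)
        (fun η _ => measurableSet_Icc.nullMeasurableSet)
        (fun i j _ hij => Icc_subset_Icc (by linarith) (by linarith))
        ⟨1, one_pos, measure_ne_top _ _⟩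
      rwa [hI] at h
    refine ge_of_tendsto hthick ?_
    filter_upwards [self_mem_nhdsWithin] with η hη
    obtain ⟨q, hq, hpq⟩ := Metric.mem_closure_iff.1 hp η hη
    rw [Prod.dist_eq, max_lt_iff, Real.dist_eq, Real.dist_eq, abs_lt, abs_lt] at hpq
    exact le_trans hq (measure_mono (Icc_subset_Icc (by linarith) (by linarith)))
  have hcomp : IsCompact ({p : ℝ × ℝ | ENNReal.ofReal δ ≤ σ (Icc p.1 p.2)} ∩
      {p | p.2 - p.1 ≤ 2 * N}) := by
    refine ((isCompact_Icc (a := ((-(3 * N) : ℝ), (-(N) : ℝ))) (b := ((N : ℝ), (3 * N : ℝ))))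
      ).of_isClosed_subset
      (hclosed.inter (isClosed_le (by fun_prop) (by fun_prop))) ?_
    rintro ⟨x, y⟩ ⟨hp, hl⟩
    obtain ⟨ha, hb, hc⟩ := hmeet x y hp
    simp only [mem_ofPred_eq] at hl
    exact ⟨⟨by dsimp; linarith, hc⟩, ⟨hb, by dsimp; linarith⟩⟩
  obtain ⟨p, ⟨hp1, hp2⟩, hpmin⟩ := hcomp.exists_isMinOn
    ⟨((-(N : ℝ)), (N : ℝ)), hN1.le, by simp only [mem_ofPred_eq]; linarith⟩
    (f := fun p : ℝ × ℝ => p.2 - p.1) (by fun_prop)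
  have hleast : IsLeast {l : ℝ | ∃ x y : ℝ, ENNReal.ofReal δ ≤ σ (Icc x y) ∧ l = |x - y|}
      (p.2 - p.1) := by
    refine ⟨⟨p.1, p.2, hp1, ?_⟩, ?_⟩
    · rw [abs_sub_comm, abs_of_nonneg (by linarith [(hmeet _ _ hp1).1])]
    · rintro l ⟨x, y, hxy, rfl⟩
      rw [abs_sub_comm, abs_of_nonneg (by linarith [(hmeet _ _ hxy).1])]
      by_cases hle : y - x ≤ 2 * N
      · exact hpmin (show (x, y) ∈ _ from ⟨hxy, hle⟩)
      · simp only [mem_ofPred_eq] at hp2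
        linarith
  have : inverseModulus σ δ = p.2 - p.1 := hleast.csInf_eq
  rwa [this]

/-! The measure `n • σ` is replaced by `n` points with nearly the right power sums, and some of the
points are then moved to make these exact. Let `τ` be the truncated measure, of mass `T`. Split `n •
σ` into a multiple of `τ` of integral mass `N = (k + 2) * M` and a remainder of mass `n - N`, and
replace each by its quantile points. The counting function of quantile points is within 1 of the
mass function, so by the layer cake formula each power sum has error at most 1 per part, hence at
most 2 in total (`exists_quantile_approx`). The `N` points coming from `τ` fall into `M` groups, by
index modulo `M`. Neighbours in a group enclose a share of at least `1 / (k + 2)` of the mass of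
`τ`, so they are at least `R`, the inverse modulus at `2 / (2k + 7)`, apart; `R` is positive because
the truncated atoms are too light. Each group has to absorb only `1 / M` of the error. Within a
group the two outer points stay and the `k` inner ones move (`exists_powerSum_eq_add`). Changing the
power sums by `D j` multiplies `∏ (1 - y t)` by `exp (-∑ D j t ^ j / j)`, modulo `t ^ (k + 1)`. This
changes the monic polynomial with roots `y` by little on the unit interval, whereas at the midpoints
between consecutive points that polynomial is large with alternating signs. So the new polynomial
keeps `k` real roots between the midpoints. `shift_lt_midpoint_bound` compares the two sizes. -/

/-! ### Newton's identities and generating functions -/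

/-- The coefficients of `∏ (1 - w i t)`, the signed elementary symmetric functions of `w`. -/
noncomputable def signedEsymm {k : ℕ} (w : Fin k → ℝ) (j : ℕ) : ℝ :=
  (-1) ^ j * (Finset.univ.val.map w).esymm j

/-- The power sums of `w` of positive order; the value at order `0` is set to `0`. -/
noncomputable def powerSum {k : ℕ} (w : Fin k → ℝ) (j : ℕ) : ℝ :=
  if j = 0 then 0 else ∑ i, w i ^ j

theorem signedEsymm_zero {k : ℕ} (w : Fin k → ℝ) : signedEsymm w 0 = 1 := by
  simp [signedEsymm, Multiset.esymm]

theorem abs_signedEsymm_le {k : ℕ} (w : Fin k → ℝ) (hw : ∀ i, w i ∈ Icc (0 : ℝ) 1) (j : ℕ) :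
    |signedEsymm w j| ≤ (k.choose j : ℝ) := by
  rw [signedEsymm, Finset.esymm_map_val, abs_mul, abs_pow, abs_neg, abs_one, one_pow, one_mul]
  refine (Finset.abs_sum_le_sum_abs _ _).trans ?_
  refine (Finset.sum_le_card_nsmul _ _ 1 fun t _ => ?_).trans ?_
  · rw [Finset.abs_prod]
    exact Finset.prod_le_one (fun i _ => abs_nonneg _) fun i _ => by
      rw [abs_of_nonneg (hw i).1]; exact (hw i).2
  · simp

/-- Newton's identities. -/
theorem signedEsymm_newton {k : ℕ} (w : Fin k → ℝ) (j : ℕ) :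
    (j : ℝ) * signedEsymm w j =
      -∑ a ∈ Finset.HasAntidiagonal.antidiagonal j, signedEsymm w a.1 * powerSum w a.2 := by
  have h := congrArg (MvPolynomial.aeval w) (MvPolynomial.mul_esymm_eq_sum (Fin k) ℝ j)
  simp only [map_mul, map_sum, map_pow, map_neg, map_one, map_natCast,
    MvPolynomial.aeval_esymm_eq_multiset_esymm] at h
  have h2 : ∑ a ∈ Finset.HasAntidiagonal.antidiagonal j, signedEsymm w a.1 * powerSum w a.2 =
      ∑ a ∈ Finset.HasAntidiagonal.antidiagonal j with a.1 < j, (-1) ^ a.1 *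
        (Finset.univ.val.map w).esymm a.1 * (MvPolynomial.aeval w) (MvPolynomial.psum (Fin k) ℝ a.2) := by
    -- The term with `a.2 = 0`, absent from Newton's identity, vanishes by the convention `powerSum
    -- w 0 = 0`.
    rw [Finset.sum_filter]
    refine Finset.sum_congr rfl fun a ha => ?_
    rw [Finset.HasAntidiagonal.mem_antidiagonal] at ha
    split_ifs with h1
    · have : a.2 ≠ 0 := by omega
      simp [powerSum, this, signedEsymm, MvPolynomial.psum]
    · have : a.2 = 0 := by omega
      simp [powerSum, this]
  rw [h2, signedEsymm, mul_left_comm, h, ← mul_assoc, ← pow_add,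
    show j + (j + 1) = 2 * j + 1 by ring, pow_succ, pow_mul]
  simp

/-- Newton's recursion determines the power sums. -/
theorem eq_of_newton {k : ℕ} {a s t : ℕ → ℝ} (ha : a 0 = 1)
    (h : ∀ j ≤ k, ∑ i ∈ Finset.HasAntidiagonal.antidiagonal j, a i.1 * s i.2 =
      ∑ i ∈ Finset.HasAntidiagonal.antidiagonal j, a i.1 * t i.2) : ∀ j ≤ k, s j = t j := by
  intro j
  induction j using Nat.strong_induction_on with
  | _ j ih =>
    intro hj
    have h1 := h j hj
    have hm : (0, j) ∈ Finset.HasAntidiagonal.antidiagonal j := by simp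
    rw [← Finset.add_sum_erase _ _ hm, ← Finset.add_sum_erase _ (fun i => a i.1 * t i.2) hm] at h1
    have h2 : ∑ i ∈ (Finset.HasAntidiagonal.antidiagonal j).erase (0, j), a i.1 * s i.2 =
        ∑ i ∈ (Finset.HasAntidiagonal.antidiagonal j).erase (0, j), a i.1 * t i.2 := by
      refine Finset.sum_congr rfl fun i hi => ?_
      rw [Finset.mem_erase, Finset.HasAntidiagonal.mem_antidiagonal] at hi
      have hlt : i.2 < j := by
        have : i.1 ≠ 0 := fun h0 => hi.1 (Prod.ext h0 (by simp only; omega))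
        omega
      rw [ih i.2 hlt (by omega)]
    simp only [ha, one_mul] at h1
    linarith

/-- The coefficients of `exp (-∑ D j t ^ j / j)`. -/
noncomputable def expCoeff (D : ℕ → ℝ) : ℕ → ℝ
  | 0 => 1
  | n + 1 => -(∑ i : Fin (n + 1), expCoeff D i * D (n + 1 - i)) / (n + 1)

theorem expCoeff_newton (D : ℕ → ℝ) (hD : D 0 = 0) (j : ℕ) :
    (j : ℝ) * expCoeff D j = -∑ a ∈ Finset.HasAntidiagonal.antidiagonal j, expCoeff D a.1 * D a.2 := by
  rw [Finset.Nat.sum_antidiagonal_eq_sum_range_succ (fun a b => expCoeff D a * D b)]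
  cases j with
  | zero => simp [hD]
  | succ n =>
    rw [Finset.sum_range_succ, expCoeff, Finset.sum_range]
    have : ((n : ℝ) + 1) ≠ 0 := by positivity
    simp only [Nat.sub_self, hD]
    push_cast
    field_simp
    ring_nf

/-- Up to sign, the recursion is an average of products `expCoeff D i * D _`. By induction all
coefficients are at most 1 in absolute value, and one more use of the recursion gains the factor
`η`. -/
theorem abs_expCoeff_le (D : ℕ → ℝ) {η : ℝ} (hη1 : η ≤ 1)
    (hD : ∀ j, |D j| ≤ η) (j : ℕ) : |expCoeff D (j + 1)| ≤ η := by
  have h1 : ∀ i, |expCoeff D i| ≤ 1 := by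
    intro i
    induction i using Nat.strong_induction_on with
    | _ i ih =>
      cases i with
      | zero => simp [expCoeff]
      | succ n =>
        rw [expCoeff, abs_div, abs_neg, abs_of_pos (by positivity : (0 : ℝ) < (n : ℝ) + 1),
          div_le_one (by positivity)]
        refine (Finset.abs_sum_le_sum_abs _ _).trans ?_
        refine (Finset.sum_le_card_nsmul _ _ 1 fun t _ => ?_).trans ?_
        · rw [abs_mul]
          exact mul_le_one₀ (ih _ (by omega)) (abs_nonneg _) ((hD _).trans hη1)
        · simp
  rw [expCoeff, abs_div, abs_neg, abs_of_pos (by positivity : (0 : ℝ) < (j : ℝ) + 1),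
    div_le_iff₀ (by positivity)]
  refine (Finset.abs_sum_le_sum_abs _ _).trans ?_
  refine (Finset.sum_le_card_nsmul _ _ η fun t _ => ?_).trans ?_
  · rw [abs_mul]
    calc _ ≤ 1 * η := mul_le_mul (h1 _) (hD _) (abs_nonneg _) zero_le_one
      _ = η := one_mul _
  · simp [mul_comm]

/-- The product rule for Newton's recursion. -/
theorem newton_mul {a g s t : ℕ → ℝ}
    (ha : ∀ j : ℕ, (j : ℝ) * a j = -∑ i ∈ Finset.HasAntidiagonal.antidiagonal j, a i.1 * s i.2)
    (hg : ∀ j : ℕ, (j : ℝ) * g j = -∑ i ∈ Finset.HasAntidiagonal.antidiagonal j, g i.1 * t i.2) (j : ℕ) :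
    (j : ℝ) * (∑ i ∈ Finset.HasAntidiagonal.antidiagonal j, a i.1 * g i.2) =
      -∑ i ∈ Finset.HasAntidiagonal.antidiagonal j,
        (∑ l ∈ Finset.HasAntidiagonal.antidiagonal i.1, a l.1 * g l.2) * (s i.2 + t i.2) := by
  -- The recursion says `X * B' = -B * U` for the generating series, so `U` is minus the logarithmic
  -- derivative times `X`, which is additive in products.
  have key : ∀ {b u : ℕ → ℝ},
      (∀ j : ℕ, (j : ℝ) * b j = -∑ i ∈ Finset.HasAntidiagonal.antidiagonal j, b i.1 * u i.2) ↔
      PowerSeries.X * PowerSeries.derivative ℝ (PowerSeries.mk b) =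
        -(PowerSeries.mk b * PowerSeries.mk u) := by
    intro b u
    rw [PowerSeries.ext_iff]
    refine forall_congr' fun n => ?_
    have : PowerSeries.coeff n (PowerSeries.X * PowerSeries.derivative ℝ (PowerSeries.mk b)) =
        n * b n := by
      cases n with
      | zero => simp
      | succ n =>
        rw [PowerSeries.coeff_succ_X_mul, PowerSeries.coeff_derivative, PowerSeries.coeff_mk]
        push_cast
        ring
    rw [this, map_neg, PowerSeries.coeff_mul]
    simp only [PowerSeries.coeff_mk]
  have hA := key.1 ha
  have hG := key.1 hg
  have hmul : PowerSeries.mk (fun j => ∑ i ∈ Finset.HasAntidiagonal.antidiagonal j, a i.1 * g i.2) =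
      PowerSeries.mk a * PowerSeries.mk g := by
    ext n
    simp [PowerSeries.coeff_mul]
  have hadd : PowerSeries.mk (fun j => s j + t j) = PowerSeries.mk s + PowerSeries.mk t := by
    ext n
    simp
  refine (key (b := fun j => ∑ i ∈ Finset.HasAntidiagonal.antidiagonal j, a i.1 * g i.2)
    (u := fun j => s j + t j)).2 ?_ j
  rw [hmul, hadd, Derivation.leibniz, smul_eq_mul, smul_eq_mul]
  linear_combination (PowerSeries.mk a) * hG + (PowerSeries.mk g) * hA

/-! ### Polynomials with prescribed coefficients -/

/-- The monic polynomial with the given sequence of coefficients, highest order first. -/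
noncomputable def polyOfSeq (k : ℕ) (a : ℕ → ℝ) : Polynomial ℝ :=
  ∑ j ∈ Finset.range (k + 1), Polynomial.C (a j) * Polynomial.X ^ (k - j)

theorem polyOfSeq_signedEsymm {k : ℕ} (w : Fin k → ℝ) :
    polyOfSeq k (signedEsymm w) = ∏ i, (Polynomial.X - Polynomial.C (w i)) := by
  have h := Multiset.prod_X_sub_X_eq_sum_esymm (Finset.univ.val.map w)
  rw [Multiset.map_map] at h
  have h2 : ∏ i, (Polynomial.X - Polynomial.C (w i)) =
    (Multiset.map ((fun t => Polynomial.X - Polynomial.C t) ∘ w) Finset.univ.val).prod := rfl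
  rw [h2, h, polyOfSeq]
  simp only [Multiset.card_map, Finset.card_val, Finset.card_univ, Fintype.card_fin]
  refine Finset.sum_congr rfl fun j _ => ?_
  simp [signedEsymm, mul_assoc]

theorem coeff_polyOfSeq (k : ℕ) (a : ℕ → ℝ) {j : ℕ} (hj : j ≤ k) :
    (polyOfSeq k a).coeff (k - j) = a j := by
  rw [polyOfSeq, Polynomial.finsetSum_coeff]
  simp only [Polynomial.coeff_C_mul_X_pow]
  rw [Finset.sum_eq_single_of_mem j (by simp; omega)]
  · simp
  · intro b hb hne
    rw [Finset.mem_range] at hb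
    rw [if_neg (by omega)]

theorem degree_polyOfSeq_sub_lt (k : ℕ) {a b : ℕ → ℝ} (h : a 0 = b 0) :
    (polyOfSeq k a - polyOfSeq k b).degree < k := by
  rw [polyOfSeq, polyOfSeq, ← Finset.sum_sub_distrib, Finset.sum_range_succ', h, sub_self, add_zero]
  refine (Polynomial.degree_sum_le _ _).trans_lt ?_
  rw [Finset.sup_lt_iff (by exact WithBot.bot_lt_coe k)]
  intro j hj
  rw [Finset.mem_range] at hj
  rw [← sub_mul, ← Polynomial.C_sub]
  refine (Polynomial.degree_C_mul_X_pow_le _ _).trans_lt ?_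
  exact_mod_cast (by omega : k - (j + 1) < k)

theorem abs_eval_polyOfSeq_sub_le (k : ℕ) {a b : ℕ → ℝ} (h : a 0 = b 0) {x : ℝ}
    (hx : x ∈ Icc (0 : ℝ) 1) :
    |(polyOfSeq k a).eval x - (polyOfSeq k b).eval x| ≤
      ∑ j ∈ Finset.range k, |a (j + 1) - b (j + 1)| := by
  rw [polyOfSeq, polyOfSeq, Polynomial.eval_finsetSum, Polynomial.eval_finsetSum,
    ← Finset.sum_sub_distrib, Finset.sum_range_succ', h, sub_self, add_zero]
  refine (Finset.abs_sum_le_sum_abs _ _).trans (Finset.sum_le_sum fun j _ => ?_)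
  simp only [Polynomial.eval_mul, Polynomial.eval_C, Polynomial.eval_pow, Polynomial.eval_X]
  rw [← sub_mul, abs_mul, abs_pow, abs_of_nonneg hx.1]
  exact mul_le_of_le_one_right (abs_nonneg _) (pow_le_one₀ hx.1 hx.2)

/-! ### Size at the midpoints -/

theorem mul_le_sub_of_gap {k : ℕ} {y : ℕ → ℝ} {R : ℝ} (hgap : ∀ s ≤ k, R ≤ y (s + 1) - y s)
    {a b : ℕ} (hab : a ≤ b) (hb : b ≤ k + 1) : ((b : ℝ) - a) * R ≤ y b - y a := by
  induction b, hab using Nat.le_induction with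
  | base => simp
  | succ b hab ih =>
    have h1 := ih (by omega)
    have h2 := hgap b (by omega)
    push_cast
    linarith

theorem factorial_mul_factorial_ge (a b : ℕ) :
    ((a + b).factorial : ℝ) / 2 ^ (a + b) ≤ (a.factorial : ℝ) * b.factorial := by
  rw [div_le_iff₀ (by positivity)]
  have h := Nat.add_choose_mul_factorial_mul_factorial a b
  have h2 := Nat.choose_le_two_pow (a + b) a
  calc ((a + b).factorial : ℝ) = ((a + b).choose a : ℝ) * (a.factorial * b.factorial) := by
        rw [← h, Nat.choose_symm_add]; push_cast; ring
    _ ≤ 2 ^ (a + b) * (a.factorial * b.factorial) := by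
        gcongr
        exact_mod_cast h2
    _ = _ := by ring

/-- A polynomial with separated roots is not small half way between two of them. -/
theorem le_abs_prod_midpoint {k : ℕ} {y : ℕ → ℝ} {R : ℝ} (hR : 0 < R)
    (hgap : ∀ s ≤ k, R ≤ y (s + 1) - y s) {i : ℕ} (hi : i ≤ k) :
    R ^ k * k.factorial / 4 ^ k ≤ |∏ l : Fin k, ((y i + y (i + 1)) / 2 - y (l + 1))| := by
  rw [Fin.prod_univ_eq_prod_range (fun l => (y i + y (i + 1)) / 2 - y (l + 1)), Finset.abs_prod]
  obtain ⟨b, rfl⟩ := Nat.exists_eq_add_of_le hi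
  have hi' := hgap i hi
  -- The `d`-th nearest root on either side of the midpoint is at distance at least `(d - 1/2) * R ≥
  -- d * R / 2`; the two sides give `i!` and `b!`.
  have h1 : ∏ l ∈ Finset.range i, (R / 2 * ((i : ℝ) - l)) ≤
      ∏ l ∈ Finset.range i, |(y i + y (i + 1)) / 2 - y (l + 1)| := by
    refine Finset.prod_le_prod (fun l hl => ?_) fun l hl => ?_
    · have : (l : ℝ) < i := by exact_mod_cast Finset.mem_range.1 hl
      have := sub_pos.2 this
      positivity
    · have hl := Finset.mem_range.1 hl
      have := mul_le_sub_of_gap hgap (show l + 1 ≤ i by omega) (by omega)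
      have hli : (l : ℝ) + 1 ≤ i := by exact_mod_cast hl
      push_cast at this
      refine le_trans ?_ (le_abs_self _)
      nlinarith
  have h2 : ∏ l ∈ Finset.range b, (R / 2 * ((l : ℝ) + 1)) ≤
      ∏ l ∈ Finset.range b, |(y i + y (i + 1)) / 2 - y (i + l + 1)| := by
    refine Finset.prod_le_prod (fun l hl => by positivity) fun l hl => ?_
    have hl := Finset.mem_range.1 hl
    have := mul_le_sub_of_gap hgap (show i + 1 ≤ i + l + 1 by omega) (by omega)
    push_cast at this
    rw [abs_sub_comm]
    refine le_trans ?_ (le_abs_self _)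
    have : (0 : ℝ) ≤ l := by positivity
    nlinarith
  have e1 : ∏ l ∈ Finset.range i, (R / 2 * ((i : ℝ) - l)) = (R / 2) ^ i * i.factorial := by
    rw [Finset.prod_mul_distrib, Finset.prod_const, Finset.card_range,
      ← Finset.prod_range_add_one_eq_factorial, ← Finset.prod_range_reflect]
    congr 1
    push_cast
    refine Finset.prod_congr rfl fun l hl => ?_
    have hl := Finset.mem_range.1 hl
    rw [Nat.sub_sub, Nat.cast_sub (by omega)]
    push_cast
    ring
  have e2 : ∏ l ∈ Finset.range b, (R / 2 * ((l : ℝ) + 1)) = (R / 2) ^ b * b.factorial := by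
    rw [Finset.prod_mul_distrib, Finset.prod_const, Finset.card_range,
      ← Finset.prod_range_add_one_eq_factorial]
    push_cast
    rfl
  rw [Finset.prod_range_add]
  calc R ^ (i + b) * (i + b).factorial / 4 ^ (i + b)
      = (R / 2) ^ (i + b) * ((i + b).factorial / 2 ^ (i + b)) := by
        rw [div_pow, show (4 : ℝ) = 2 * 2 by norm_num, mul_pow]
        field_simp
    _ ≤ (R / 2) ^ (i + b) * (i.factorial * b.factorial) := by
        gcongr
        exact factorial_mul_factorial_ge i b
    _ = ((R / 2) ^ i * i.factorial) * ((R / 2) ^ b * b.factorial) := by ring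
    _ ≤ _ := by
        rw [← e1, ← e2]
        exact mul_le_mul h1 h2 (by rw [e2]; positivity) (Finset.prod_nonneg fun _ _ => abs_nonneg _)

/-- Exchanging the sums gives `∑ (k - i) * choose k i = k * ∑ choose (k - 1) i`. This adds up the
coefficient errors of the perturbed polynomial. -/
theorem sum_sum_choose (k : ℕ) :
    ∑ j ∈ Finset.range k, ∑ i ∈ Finset.range (j + 1), (k.choose i : ℝ) = k * 2 ^ (k - 1) := by
  cases k with
  | zero => simp
  | succ m =>
    have h : ∀ n ≤ m + 1, ∑ j ∈ Finset.range n, ∑ i ∈ Finset.range (j + 1), ((m + 1).choose i : ℝ) =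
        ∑ i ∈ Finset.range n, ((n : ℝ) - i) * (m + 1).choose i := by
      intro n
      induction n with
      | zero => simp
      | succ n ih =>
        intro hn
        rw [Finset.sum_range_succ, ih (by omega), Finset.sum_range_succ (fun i => ((m+1).choose i : ℝ)),
          ← add_assoc, ← Finset.sum_add_distrib, Finset.sum_range_succ _ n]
        congr 1
        · refine Finset.sum_congr rfl fun i _ => ?_
          push_cast
          ring
        · push_cast
          ring
    rw [h _ le_rfl, Nat.add_sub_cancel]
    have h2 : ∀ i ∈ Finset.range (m + 1), (((m + 1 : ℕ) : ℝ) - i) * (m + 1).choose i =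
        ((m + 1 : ℕ) : ℝ) * m.choose i := by
      intro i hi
      have hi := Finset.mem_range.1 hi
      have := Nat.choose_mul_succ_eq m i
      rw [← Nat.cast_sub (by omega)]
      rw [mul_comm]
      exact_mod_cast (by rw [← this, mul_comm])
    rw [Finset.sum_congr rfl h2, ← Finset.mul_sum]
    congr 1
    exact_mod_cast Nat.sum_range_choose m

/-! ### Moving separated points -/

/-- A small change of the first `k` power sums of `k` separated points of the unit interval
is realised by moving the points inside the unit interval. -/
theorem exists_powerSum_eq_add {k : ℕ} {y : ℕ → ℝ} {R η : ℝ} (hR : 0 < R)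
    (hy : ∀ s ≤ k + 1, y s ∈ Icc (0 : ℝ) 1) (hgap : ∀ s ≤ k, R ≤ y (s + 1) - y s)
    {D : ℕ → ℝ} (hD0 : D 0 = 0) (hη1 : η ≤ 1) (hD : ∀ j, |D j| ≤ η)
    (hη : η * (k * 2 ^ (k - 1)) < R ^ k * k.factorial / 4 ^ k) :
    ∃ w : Fin k → ℝ, (∀ i, w i ∈ Icc (0 : ℝ) 1) ∧ ∀ j : ℕ, 1 ≤ j → j ≤ k →
      ∑ i, w i ^ j = ∑ i : Fin k, y (i + 1) ^ j + D j := by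
  have hη0 : 0 ≤ η := (abs_nonneg _).trans (hD 0)
  set v : Fin k → ℝ := fun i => y (i + 1) with hv
  have hv01 : ∀ i, v i ∈ Icc (0 : ℝ) 1 := fun i => hy _ (by omega)
  set a := signedEsymm v
  set a' : ℕ → ℝ := fun j => ∑ i ∈ Finset.HasAntidiagonal.antidiagonal j, a i.1 * expCoeff D i.2 with ha'
  have ha0 : a 0 = 1 := signedEsymm_zero v
  have ha'0 : a' 0 = 1 := by simp [ha', ha0, expCoeff]
  have hdiff : ∀ j ∈ Finset.range k, |a' (j + 1) - a (j + 1)| ≤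
      ∑ i ∈ Finset.range (j + 1), η * (k.choose i : ℝ) := by
    intro j _
    have : a' (j + 1) - a (j + 1) =
        ∑ i ∈ Finset.range (j + 1), a i * expCoeff D (j + 1 - i) := by
      rw [ha']
      simp only
      rw [Finset.Nat.sum_antidiagonal_eq_sum_range_succ (fun p q => a p * expCoeff D q),
        Finset.sum_range_succ, Nat.sub_self]
      simp [expCoeff]
    rw [this]
    refine (Finset.abs_sum_le_sum_abs _ _).trans (Finset.sum_le_sum fun i hi => ?_)
    have hi := Finset.mem_range.1 hi
    rw [abs_mul, mul_comm]
    refine mul_le_mul ?_ (abs_signedEsymm_le v hv01 i) (abs_nonneg _) hη0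
    have := abs_expCoeff_le D hη1 hD (j - i)
    rwa [show j + 1 - i = j - i + 1 by omega]
  set P := polyOfSeq k a with hP
  set Q := polyOfSeq k a' with hQ
  have hPQ : ∀ x ∈ Icc (0 : ℝ) 1, |Q.eval x - P.eval x| ≤ η * (k * 2 ^ (k - 1)) := by
    intro x hx
    refine (abs_eval_polyOfSeq_sub_le k (ha'0.trans ha0.symm) hx).trans ?_
    refine (Finset.sum_le_sum hdiff).trans_eq ?_
    simp_rw [← Finset.mul_sum]
    rw [sum_sum_choose]
  have hPeval : ∀ x, P.eval x = ∏ l : Fin k, (x - y (l + 1)) := by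
    intro x
    rw [hP, polyOfSeq_signedEsymm, Polynomial.eval_prod]
    simp [hv]
  -- The `k + 1` midpoints of `y 0, …, y (k + 1)` bracket the roots `y 1, …, y k`; the outer points
  -- serve only to keep `z 0` and `z k` in the unit interval.
  set z : ℕ → ℝ := fun i => (y i + y (i + 1)) / 2 with hz
  have hz01 : ∀ i ≤ k, z i ∈ Icc (0 : ℝ) 1 := by
    intro i hi
    have h1 := hy i (by omega)
    have h2 := hy (i + 1) (by omega)
    simp only [hz, mem_Icc] at *
    constructor <;> linarith
  have hzlt : ∀ i < k, z i < z (i + 1) := by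
    intro i hi
    have h1 := hgap i (by omega)
    have h2 := hgap (i + 1) (by omega)
    simp only [hz]
    linarith
  have hsame : ∀ i ≤ k, 0 < Q.eval (z i) * P.eval (z i) := by
    intro i hi
    have h1 := hPQ _ (hz01 i hi)
    have h2 := le_abs_prod_midpoint hR hgap hi
    rw [← hPeval] at h2
    have h3 : |Q.eval (z i) - P.eval (z i)| < |P.eval (z i)| := by
      exact (h1.trans_lt hη).trans_le h2
    have h4 := sq_lt_sq.2 h3
    nlinarith [sq_nonneg (Q.eval (z i))]
  -- Only the factor with root `y (i + 1)` changes sign between `z i` and `z (i + 1)`.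
  have halt : ∀ i < k, P.eval (z i) * P.eval (z (i + 1)) < 0 := by
    intro i hi
    rw [hPeval, hPeval, ← Finset.prod_mul_distrib,
      ← Finset.mul_prod_erase _ _ (Finset.mem_univ (⟨i, hi⟩ : Fin k))]
    have g1 := hgap i (by omega)
    have g2 := hgap (i + 1) (by omega)
    refine mul_neg_of_neg_of_pos ?_ (Finset.prod_pos fun l hl => ?_)
    · simp only [hz]
      exact mul_neg_of_neg_of_pos (by linarith) (by linarith)
    · have hne : (l : ℕ) ≠ i := fun h => (Finset.mem_erase.1 hl).1 (Fin.ext h)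
      simp only [hz]
      rcases lt_or_gt_of_ne hne with h | h
      · have h1 := mul_le_sub_of_gap hgap (show (l : ℕ) + 1 ≤ i by omega) (by omega)
        have h2 : (0 : ℝ) ≤ (i : ℝ) - ((l + 1 : ℕ) : ℝ) :=
          sub_nonneg.2 (by exact_mod_cast h)
        have h3 := mul_nonneg h2 hR.le
        exact mul_pos (by linarith) (by linarith)
      · have h1 := mul_le_sub_of_gap hgap (show i + 2 ≤ (l : ℕ) + 1 by omega) (by omega)
        have h2 : (0 : ℝ) ≤ ((l + 1 : ℕ) : ℝ) - ((i + 2 : ℕ) : ℝ) :=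
          sub_nonneg.2 (by exact_mod_cast (by omega))
        have h3 := mul_nonneg h2 hR.le
        exact mul_pos_of_neg_of_neg (by linarith) (by linarith)
  have hroot : ∀ i : Fin k, ∃ w ∈ Ioo (z i) (z (i + 1)), Q.eval w = 0 := by
    intro i
    have hs : Q.eval (z i) * Q.eval (z (i + 1)) < 0 := by
      have h1 := hsame i i.2.le
      have h2 := hsame (i + 1) i.2
      have h3 := halt i i.2
      by_contra hcon
      have h4 := mul_pos h1 h2
      nlinarith
    have hc : ContinuousOn (fun x => Q.eval x) (Icc (z i) (z (i + 1))) := Q.continuous.continuousOn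
    rcases mul_neg_iff.1 hs with ⟨h1, h2⟩ | ⟨h1, h2⟩
    · obtain ⟨w, hw, h⟩ := intermediate_value_Ioo' (hzlt i i.2).le hc ⟨h2, h1⟩
      exact ⟨w, hw, h⟩
    · obtain ⟨w, hw, h⟩ := intermediate_value_Ioo (hzlt i i.2).le hc ⟨h1, h2⟩
      exact ⟨w, hw, h⟩
  choose w hw hw0 using hroot
  have hzmono : ∀ i j, i ≤ j → j ≤ k → z i ≤ z j := by
    intro i j hij
    induction j, hij using Nat.le_induction with
    | base => exact fun _ => le_rfl
    | succ j hij ih => exact fun hj => (ih (by omega)).trans (hzlt j (by omega)).le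
  have hwmono : StrictMono w := by
    intro i j hij
    exact ((hw i).2.trans_le (hzmono _ _ (by exact_mod_cast hij) (by omega))).trans (hw j).1
  -- Both are monic of degree `k` and agree at the `k` distinct points `w i`.
  have hQw : Q = polyOfSeq k (signedEsymm w) := by
    refine Polynomial.eq_of_degree_sub_lt_of_eval_finset_eq (Finset.univ.image w) ?_ ?_
    · rw [Finset.card_image_of_injective _ hwmono.injective, Finset.card_univ, Fintype.card_fin]
      exact degree_polyOfSeq_sub_lt k (ha'0.trans (signedEsymm_zero w).symm)
    · intro x hx
      obtain ⟨i, -, rfl⟩ := Finset.mem_image.1 hx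
      rw [hw0, polyOfSeq_signedEsymm, Polynomial.eval_prod]
      exact (Finset.prod_eq_zero (Finset.mem_univ i) (by simp)).symm
  have hcoef : ∀ j ≤ k, signedEsymm w j = a' j := by
    intro j hj
    rw [← coeff_polyOfSeq k (signedEsymm w) hj, ← hQw, hQ, coeff_polyOfSeq k a' hj]
  refine ⟨w, fun i => ⟨(hz01 i i.2.le).1.trans (hw i).1.le,
    (hw i).2.le.trans (hz01 (i + 1) i.2).2⟩, fun j hj1 hjk => ?_⟩
  -- The coefficients `a'` satisfy Newton's recursion with `powerSum v + D`, and as coefficients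
  -- from `w` also with `powerSum w`; the recursion determines its power sums.
  have hnew := newton_mul (signedEsymm_newton v) (expCoeff_newton D hD0)
  have hfin := eq_of_newton (k := k) (a := signedEsymm w) (s := powerSum w)
    (t := fun j => powerSum v j + D j) (signedEsymm_zero w) ?_ j hjk
  · have hj0 : j ≠ 0 := by omega
    simpa [powerSum, hj0] using hfin
  · intro m hm
    have h1 := signedEsymm_newton w m
    have h2 := hnew m
    have h3 : ∑ i ∈ Finset.HasAntidiagonal.antidiagonal m,
        signedEsymm w i.1 * (powerSum v i.2 + D i.2) =
        ∑ i ∈ Finset.HasAntidiagonal.antidiagonal m, a' i.1 * (powerSum v i.2 + D i.2) := by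
      refine Finset.sum_congr rfl fun i hi => ?_
      rw [Finset.HasAntidiagonal.mem_antidiagonal] at hi
      rw [hcoef i.1 (by omega)]
    rw [hcoef m hm] at h1
    have h4 : (m : ℝ) * a' m = _ := h2
    rw [h3]
    linarith

/-! ### Quantile points -/

/-- The points `sInf {x | i + 1 ≤ μ (Iic x)}` for a finite measure `μ`. -/
noncomputable def quantilePoint (μ : Measure ℝ) (i : ℕ) : ℝ :=
  sInf {x : ℝ | (i : ℝ) + 1 ≤ μ.real (Iic x)}

section
variable {μ : Measure ℝ} [IsFiniteMeasure μ] {N : ℕ}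

theorem real_Iic_mono : Monotone fun x => μ.real (Iic x) :=
  fun _ _ h => measureReal_mono (Iic_subset_Iic.2 h)

theorem real_Iic_of_one_le (h01 : μ (Icc (0 : ℝ) 1)ᶜ = 0) (hN : μ.real univ = N) {x : ℝ}
    (hx : 1 ≤ x) : μ.real (Iic x) = N := by
  have h : μ (Iic x)ᶜ = 0 := measure_mono_null (by
    intro t ht h
    simp only [mem_compl_iff, mem_Iic] at ht
    exact ht (h.2.trans hx)) h01
  have h2 := measureReal_add_measureReal_compl (μ := μ) (measurableSet_Iic (a := x))
  rw [Measure.real, Measure.real, h] at h2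
  rw [← hN, ← h2]
  simp [Measure.real]

theorem real_Iic_of_neg {μ : Measure ℝ} (h01 : μ (Icc (0 : ℝ) 1)ᶜ = 0) {x : ℝ} (hx : x < 0) :
    μ.real (Iic x) = 0 := by
  have h : μ (Iic x) = 0 := measure_mono_null (by
    intro t ht h
    exact absurd (h.1.trans ht) (not_le.2 hx)) h01
  simp [Measure.real, h]

theorem quantileSet_bddBelow {μ : Measure ℝ} (h01 : μ (Icc (0 : ℝ) 1)ᶜ = 0) (i : ℕ) {x : ℝ}
    (hx : (i : ℝ) + 1 ≤ μ.real (Iic x)) : 0 ≤ x := by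
  by_contra h
  rw [real_Iic_of_neg h01 (not_le.1 h)] at hx
  have : (0 : ℝ) ≤ i := by positivity
  linarith

theorem one_mem_quantileSet (h01 : μ (Icc (0 : ℝ) 1)ᶜ = 0) (hN : μ.real univ = N) {i : ℕ}
    (hi : i < N) : (i : ℝ) + 1 ≤ μ.real (Iic 1) := by
  rw [real_Iic_of_one_le h01 hN le_rfl]
  exact_mod_cast hi

theorem quantilePoint_mem_Icc (h01 : μ (Icc (0 : ℝ) 1)ᶜ = 0) (hN : μ.real univ = N) {i : ℕ}
    (hi : i < N) : quantilePoint μ i ∈ Icc (0 : ℝ) 1 :=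
  ⟨le_csInf ⟨1, one_mem_quantileSet h01 hN hi⟩ fun _ hx => quantileSet_bddBelow h01 i hx,
    csInf_le ⟨0, fun _ hx => quantileSet_bddBelow h01 i hx⟩ (one_mem_quantileSet h01 hN hi)⟩

theorem tendsto_real_Iic (x : ℝ) :
    Filter.Tendsto (fun t => μ.real (Iic t)) (nhdsWithin x (Ioi x)) (nhds (μ.real (Iic x))) := by
  have hI : (⋂ t : ℝ, ⋂ _ : t > x, Iic t) = Iic x := by
    ext z
    simp only [mem_iInter, mem_Iic]
    exact ⟨fun h => le_of_forall_gt_imp_ge_of_dense h, fun h t ht => h.trans ht.le⟩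
  have h := tendsto_measure_biInter_gt (μ := μ) (s := fun t : ℝ => Iic t) (a := x)
    (fun t _ => measurableSet_Iic.nullMeasurableSet)
    (fun i j _ hij => Iic_subset_Iic.2 hij) ⟨x + 1, by simp, measure_ne_top _ _⟩
  rw [hI] at h
  exact (ENNReal.tendsto_toReal (measure_ne_top _ _)).comp h

theorem quantilePoint_le_iff (h01 : μ (Icc (0 : ℝ) 1)ᶜ = 0) (hN : μ.real univ = N) {i : ℕ}
    (hi : i < N) {x : ℝ} : quantilePoint μ i ≤ x ↔ (i : ℝ) + 1 ≤ μ.real (Iic x) := by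
  constructor
  · intro h
    refine ge_of_tendsto (tendsto_real_Iic x) ?_
    filter_upwards [self_mem_nhdsWithin] with t ht
    obtain ⟨u, hu, hut⟩ := exists_lt_of_csInf_lt ⟨1, one_mem_quantileSet h01 hN hi⟩
      (lt_of_le_of_lt h ht)
    exact le_trans hu (real_Iic_mono hut.le)
  · exact fun h => csInf_le ⟨0, fun _ hx => quantileSet_bddBelow h01 i hx⟩ h

/-- Left of the quantile the distribution function stays below `i + 1`, and `Iio` is the increasing
union of such half-lines. An atom at the quantile is thereby excluded. -/
theorem real_Iio_quantilePoint_le (h01 : μ (Icc (0 : ℝ) 1)ᶜ = 0) (hN : μ.real univ = N) {i : ℕ}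
    (hi : i < N) : μ.real (Iio (quantilePoint μ i)) ≤ i + 1 := by
  set q := quantilePoint μ i with hq
  obtain ⟨u, hu, hlt, hlim⟩ := exists_seq_strictMono_tendsto q
  have hU : (⋃ n, Iic (u n)) = Iio q := by
    ext z
    simp only [mem_iUnion, mem_Iic, mem_Iio]
    constructor
    · rintro ⟨n, hn⟩
      exact hn.trans_lt (hlt n)
    · intro hz
      obtain ⟨n, hn⟩ := (hlim.eventually (lt_mem_nhds hz)).exists
      exact ⟨n, hn.le⟩
  have h := tendsto_measure_iUnion_atTop (μ := μ) (s := fun n => Iic (u n))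
    (fun a b hab => Iic_subset_Iic.2 (hu.monotone hab))
  rw [hU] at h
  have h' := (ENNReal.tendsto_toReal (measure_ne_top μ (Iio q))).comp h
  refine le_of_tendsto h' (Filter.Eventually.of_forall fun n => ?_)
  by_contra hcon
  exact absurd ((quantilePoint_le_iff h01 hN hi).2 (not_le.1 hcon).le) (not_le.2 (hlt n))

theorem sub_le_real_Icc_quantilePoint (h01 : μ (Icc (0 : ℝ) 1)ᶜ = 0) (hN : μ.real univ = N)
    {i j : ℕ} (hi : i < N) (hj : j < N) :
    (j : ℝ) - i ≤ μ.real (Icc (quantilePoint μ i) (quantilePoint μ j)) := by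
  have h1 := real_Iio_quantilePoint_le h01 hN hi
  have h2 := (quantilePoint_le_iff h01 hN hj).1 le_rfl
  have h3 : μ.real (Iic (quantilePoint μ j)) ≤ μ.real (Iio (quantilePoint μ i)) +
      μ.real (Icc (quantilePoint μ i) (quantilePoint μ j)) := by
    refine (measureReal_mono ?_).trans (measureReal_union_le _ _)
    intro t ht
    rcases lt_or_ge t (quantilePoint μ i) with h | h
    · exact Or.inl h
    · exact Or.inr ⟨h, ht⟩
  linarith

theorem quantilePoint_mono (h01 : μ (Icc (0 : ℝ) 1)ᶜ = 0) (hN : μ.real univ = N)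
    {i j : ℕ} (hij : i ≤ j) (hj : j < N) : quantilePoint μ i ≤ quantilePoint μ j := by
  rw [quantilePoint_le_iff h01 hN (hij.trans_lt hj)]
  have h := (quantilePoint_le_iff h01 hN hj).1 le_rfl
  have : (i : ℝ) ≤ j := by exact_mod_cast hij
  linarith

/-- The number of quantile points above `s` exceeds the mass above `s` by at most one. -/
theorem card_quantilePoint_gt (h01 : μ (Icc (0 : ℝ) 1)ᶜ = 0) (hN : μ.real univ = N) (s : ℝ) :
    μ.real (Ioi s) ≤ ((Finset.range N).filter fun i => s < quantilePoint μ i).card ∧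
    (((Finset.range N).filter fun i => s < quantilePoint μ i).card : ℝ) ≤ μ.real (Ioi s) + 1 := by
  have hF : μ.real (Iic s) ≤ N := by
    rw [← hN]; exact measureReal_mono (subset_univ _)
  have hF0 : 0 ≤ μ.real (Iic s) := measureReal_nonneg
  have hcompl : μ.real (Iic s) + μ.real (Ioi s) = N := by
    rw [← hN, ← compl_Iic]; exact measureReal_add_measureReal_compl measurableSet_Iic
  -- Exactly `⌊μ (Iic s)⌋` quantile points lie at or below `s`; rounding down is the only
  -- discrepancy.
  have hset : (Finset.range N).filter (fun i => ¬ s < quantilePoint μ i) =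
      Finset.range ⌊μ.real (Iic s)⌋₊ := by
    ext i
    simp only [Finset.mem_filter, Finset.mem_range, not_lt]
    constructor
    · rintro ⟨hi, h⟩
      have := (quantilePoint_le_iff h01 hN hi).1 h
      exact Nat.lt_of_succ_le (Nat.le_floor (by push_cast; exact this))
    · intro h
      have h2 : ((i + 1 : ℕ) : ℝ) ≤ μ.real (Iic s) :=
        (Nat.le_floor_iff hF0).1 (Nat.succ_le_of_lt h)
      have hi : i < N := by
        have : ((i + 1 : ℕ) : ℝ) ≤ N := h2.trans hF
        exact_mod_cast this
      exact ⟨hi, (quantilePoint_le_iff h01 hN hi).2 (by push_cast at h2; exact h2)⟩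
  have hsum := Finset.card_filter_add_card_filter_not (s := Finset.range N)
    (fun i => s < quantilePoint μ i)
  rw [hset, Finset.card_range, Finset.card_range] at hsum
  have hsum' : (((Finset.range N).filter fun i => s < quantilePoint μ i).card : ℝ) +
      (⌊μ.real (Iic s)⌋₊ : ℝ) = N := by exact_mod_cast hsum
  have h1 := Nat.floor_le hF0
  have h2 := Nat.lt_floor_add_one (μ.real (Iic s))
  constructor <;> linarith

/-! ### Moments of the quantile points -/

/-- Layer cake formula for powers on the unit interval. -/
theorem integral_pow_eq_integral_Ioc (h01 : μ (Icc (0 : ℝ) 1)ᶜ = 0) {j : ℕ} (hj : j ≠ 0) :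
    ∫ t, t ^ j ∂μ = ∫ t in Ioc (0 : ℝ) 1, μ.real (Ioi (t ^ (1 / (j : ℝ)))) := by
  have hae : ∀ᵐ t ∂μ, t ∈ Icc (0 : ℝ) 1 := h01
  have hcong : ∫ t, t ^ j ∂μ = ∫ t, (max t 0) ^ j ∂μ := by
    refine integral_congr_ae ?_
    filter_upwards [hae] with t ht
    rw [max_eq_left ht.1]
  have hint : Integrable (fun t : ℝ => (max t 0) ^ j) μ := by
    refine Integrable.of_bound (by fun_prop) 1 ?_
    filter_upwards [hae] with t ht
    rw [max_eq_left ht.1, Real.norm_eq_abs, abs_pow, abs_of_nonneg ht.1]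
    exact pow_le_one₀ ht.1 ht.2
  rw [hcong, hint.integral_eq_integral_meas_lt (Filter.Eventually.of_forall fun t => by
    simp only [Pi.zero_apply]; positivity)]
  have hset : ∀ t ∈ Ioi (0 : ℝ), {a : ℝ | t < (max a 0) ^ j} = Ioi (t ^ (1 / (j : ℝ))) := by
    intro t ht
    have ht : 0 < t := ht
    have hs : 0 < t ^ (1 / (j : ℝ)) := Real.rpow_pos_of_pos ht _
    have hpow : (t ^ (1 / (j : ℝ))) ^ j = t := by
      rw [one_div]; exact Real.rpow_inv_natCast_pow ht.le hj
    ext a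
    simp only [mem_ofPred_eq, mem_Ioi]
    conv_lhs => rw [← hpow]
    rw [pow_lt_pow_iff_left₀ hs.le (le_max_right _ _) hj, lt_max_iff]
    exact ⟨fun h => h.resolve_right (not_lt.2 hs.le), Or.inl⟩
  rw [setIntegral_congr_fun measurableSet_Ioi (g := fun t => μ.real (Ioi (t ^ (1 / (j : ℝ)))))
    (fun t ht => by simp only; rw [hset t ht])]
  refine setIntegral_eq_of_subset_of_forall_sdiff_eq_zero measurableSet_Ioi Ioc_subset_Ioi_self ?_
  rintro t ⟨ht0, ht1⟩
  have ht : 1 < t := by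
    by_contra h
    exact ht1 ⟨ht0, not_lt.1 h⟩
  have hs : 1 ≤ t ^ (1 / (j : ℝ)) := Real.one_le_rpow ht.le (by positivity)
  have : μ (Ioi (t ^ (1 / (j : ℝ)))) = 0 := measure_mono_null (by
    intro a ha h
    exact absurd (h.2.trans hs) (not_le.2 ha)) h01
  rw [Measure.real, this, ENNReal.toReal_zero]

theorem integrableOn_real_Ioi_rpow (j : ℕ) :
    IntegrableOn (fun t : ℝ => μ.real (Ioi (t ^ (1 / (j : ℝ))))) (Ioc 0 1) := by
  have h : AntitoneOn (fun t : ℝ => μ.real (Ioi (t ^ (1 / (j : ℝ))))) (Icc 0 1) := by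
    intro a ha b _ hab
    exact measureReal_mono (Ioi_subset_Ioi (Real.rpow_le_rpow ha.1 hab (by positivity)))
  exact (h.integrableOn_isCompact isCompact_Icc).mono_set Ioc_subset_Icc_self

/-- The power sums of the quantile points differ from the moments by at most one. -/
theorem abs_sum_quantilePoint_pow_sub_le (h01 : μ (Icc (0 : ℝ) 1)ᶜ = 0) (hN : μ.real univ = N)
    {j : ℕ} (hj : j ≠ 0) :
    |∫ t, t ^ j ∂μ - ∑ i ∈ Finset.range N, quantilePoint μ i ^ j| ≤ 1 := by
  set ν : Measure ℝ := ∑ i ∈ Finset.range N, Measure.dirac (quantilePoint μ i) with hν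
  have hνfin : IsFiniteMeasure ν := by
    constructor
    rw [hν, Measure.finsetSum_apply]
    simp
  have hν01 : ν (Icc (0 : ℝ) 1)ᶜ = 0 := by
    rw [hν, Measure.finsetSum_apply]
    refine Finset.sum_eq_zero fun i hi => ?_
    rw [Measure.dirac_apply' _ measurableSet_Icc.compl]
    simpa using quantilePoint_mem_Icc h01 hN (Finset.mem_range.1 hi)
  have hνint : ∫ t, t ^ j ∂ν = ∑ i ∈ Finset.range N, quantilePoint μ i ^ j := by
    rw [hν, integral_finsetSum_measure]
    · simp
    · intro i _
      exact integrable_dirac (by simp)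
  have hνIoi : ∀ s, ν.real (Ioi s) =
      ((Finset.range N).filter fun i => s < quantilePoint μ i).card := by
    intro s
    rw [Measure.real, hν, Measure.finsetSum_apply, Finset.card_filter, ENNReal.toReal_sum]
    · push_cast
      refine Finset.sum_congr rfl fun i _ => ?_
      rw [Measure.dirac_apply' _ measurableSet_Ioi]
      by_cases h : s < quantilePoint μ i <;> simp [h]
    · exact fun i _ => measure_ne_top _ _
  rw [← hνint, integral_pow_eq_integral_Ioc h01 hj, integral_pow_eq_integral_Ioc hν01 hj,
    ← integral_sub (integrableOn_real_Ioi_rpow j) (integrableOn_real_Ioi_rpow j),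
    ← Real.norm_eq_abs]
  refine (norm_setIntegral_le_of_norm_le_const (C := 1) (by simp) fun t _ => ?_).trans ?_
  · rw [hνIoi, Real.norm_eq_abs, abs_le]
    have h := card_quantilePoint_gt h01 hN (t ^ (1 / (j : ℝ)))
    constructor <;> linarith [h.1, h.2]
  · simp
end

/-! ### The numerical inequality -/

theorem two_mul_pow_succ_le (m : ℕ) : 2 * (m : ℝ) ^ (m + 1) ≤ ((m : ℝ) + 1) ^ (m + 1) := by
  rcases Nat.eq_zero_or_pos m with rfl | hm
  · simp
  have hm' : (0 : ℝ) < m := by exact_mod_cast hm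
  have h := one_add_mul_le_pow (a := 1 / (m : ℝ)) (by
    have : 0 ≤ 1 / (m : ℝ) := by positivity
    linarith) (m + 1)
  have h2 : (2 : ℝ) ≤ 1 + ((m + 1 : ℕ) : ℝ) * (1 / m) := by
    have : ((m + 1 : ℕ) : ℝ) * (1 / m) = 1 + 1 / m := by push_cast; field_simp
    have : 0 ≤ 1 / (m : ℝ) := by positivity
    linarith
  calc 2 * (m : ℝ) ^ (m + 1) ≤ (1 + 1 / (m : ℝ)) ^ (m + 1) * (m : ℝ) ^ (m + 1) := by
        gcongr
        exact h2.trans h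
    _ = _ := by
        rw [← mul_pow]
        congr 1
        field_simp

theorem mul_two_pow_lt_three_pow (m : ℕ) : (m + 1) * 2 ^ (m + 1) < 3 ^ (m + 1) := by
  induction m with
  | zero => norm_num
  | succ m ih =>
    rcases m with _ | _ | m
    · norm_num
    · norm_num
    · rw [pow_succ 3, pow_succ 2]
      have : 0 < 2 ^ (m + 1 + 1 + 1) := by positivity
      nlinarith

theorem exp_mul_div_pow_le_factorial {k : ℕ} (hk : 2 ≤ k) :
    Real.exp 1 * ((k : ℝ) / Real.exp 1) ^ k ≤ k.factorial := by
  refine le_trans ?_ (Stirling.le_factorial_stirling k)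
  gcongr
  apply Real.le_sqrt_of_sq_le
  have h1 := Real.exp_one_lt_d9
  have h2 := Real.pi_gt_three
  have h3 : (2 : ℝ) ≤ k := by exact_mod_cast hk
  nlinarith [Real.exp_pos 1]

/-- With `k = m + 1` and `k! ≥ e * (k / e) ^ k`, the powers of `R` and `e` cancel. What remains,
`key`, is the product of `2 * m ^ (m + 1) ≤ (m + 1) ^ (m + 1)` and `(m + 1) * 2 ^ (m + 1) < 3 ^ (m +
1)`. -/
theorem shift_lt_midpoint_bound {k : ℕ} (hk : 2 ≤ k) {R ρ : ℝ} (hR : 0 < R)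
    (hρ : ρ = ((k : ℝ) - 1) * R) :
    ρ / 3 * (ρ / (12 * Real.exp 1)) ^ (k - 1) * (k * 2 ^ (k - 1)) <
      R ^ k * k.factorial / 4 ^ k := by
  have hfac := exp_mul_div_pow_le_factorial hk
  obtain ⟨m, rfl⟩ := Nat.exists_eq_add_of_le' (show 1 ≤ k by omega)
  have hm : (0 : ℝ) < m := by exact_mod_cast (by omega : 0 < m)
  have he := Real.exp_pos 1
  set e := Real.exp 1
  rw [Nat.add_sub_cancel]
  push_cast at hρ hfac ⊢
  rw [add_sub_cancel_right] at hρ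
  have h1 : 2 * (m : ℝ) ^ (m + 1) ≤ ((m : ℝ) + 1) ^ (m + 1) := two_mul_pow_succ_le m
  have h2 : ((m : ℝ) + 1) * 2 ^ (m + 1) < 3 ^ (m + 1) := by
    exact_mod_cast mul_two_pow_lt_three_pow m
  have key : 4 * ((m : ℝ) + 1) * m ^ (m + 1) * 4 ^ m < 3 * 6 ^ m * ((m : ℝ) + 1) ^ (m + 1) := by
    have e4 : (4 : ℝ) ^ m = 2 ^ m * 2 ^ m := by rw [← mul_pow]; norm_num
    have e6 : (6 : ℝ) ^ m = 2 ^ m * 3 ^ m := by rw [← mul_pow]; norm_num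
    calc 4 * ((m : ℝ) + 1) * m ^ (m + 1) * 4 ^ m
        = (((m : ℝ) + 1) * 2 ^ (m + 1)) * 2 ^ m * (2 * m ^ (m + 1)) := by rw [e4, pow_succ 2 m]; ring
      _ ≤ (((m : ℝ) + 1) * 2 ^ (m + 1)) * 2 ^ m * ((m : ℝ) + 1) ^ (m + 1) := by gcongr
      _ < 3 ^ (m + 1) * 2 ^ m * ((m : ℝ) + 1) ^ (m + 1) := by gcongr
      _ = _ := by rw [e6, pow_succ 3 m]; ring
  calc ρ / 3 * (ρ / (12 * e)) ^ m * (((m : ℝ) + 1) * 2 ^ m)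
      = R ^ (m + 1) / e ^ m * (4 * ((m : ℝ) + 1) * m ^ (m + 1) * 4 ^ m / (12 * 24 ^ m)) := by
        have h12 : (24 : ℝ) ^ m = 12 ^ m * 2 ^ m := by rw [← mul_pow]; norm_num
        have e4 : (4 : ℝ) ^ m = 2 ^ m * 2 ^ m := by rw [← mul_pow]; norm_num
        rw [hρ, div_pow, mul_pow, mul_pow, h12, e4]
        field_simp
        ring
    _ < R ^ (m + 1) / e ^ m * (3 * 6 ^ m * ((m : ℝ) + 1) ^ (m + 1) / (12 * 24 ^ m)) := by gcongr
    _ = R ^ (m + 1) * (e * (((m : ℝ) + 1) / e) ^ (m + 1)) / 4 ^ (m + 1) := by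
        have h24 : (24 : ℝ) ^ m = 6 ^ m * 4 ^ m := by rw [← mul_pow]; norm_num
        rw [div_pow, h24]
        field_simp
        ring
    _ ≤ _ := by gcongr

/-- Version of `exists_powerSum_eq_add` where the two outer points are included. -/
theorem exists_powerSum_eq_add' {k : ℕ} {y : ℕ → ℝ} {R η : ℝ} (hR : 0 < R)
    (hy : ∀ s ≤ k + 1, y s ∈ Icc (0 : ℝ) 1) (hgap : ∀ s ≤ k, R ≤ y (s + 1) - y s)
    {D : ℕ → ℝ} (hD0 : D 0 = 0) (hη1 : η ≤ 1) (hD : ∀ j, |D j| ≤ η)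
    (hη : η * (k * 2 ^ (k - 1)) < R ^ k * k.factorial / 4 ^ k) :
    ∃ w : Fin (k + 2) → ℝ, (∀ i, w i ∈ Icc (0 : ℝ) 1) ∧ ∀ j : ℕ, 1 ≤ j → j ≤ k →
      ∑ i, w i ^ j = ∑ i : Fin (k + 2), y i ^ j + D j := by
  obtain ⟨w, hw, h⟩ := exists_powerSum_eq_add hR hy hgap hD0 hη1 hD hη
  refine ⟨Fin.cons (y 0) (Fin.snoc (α := fun _ => ℝ) w (y (k + 1))), fun i => ?_, fun j h1 h2 => ?_⟩
  · refine Fin.cases ?_ (fun i => ?_) i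
    · simpa using hy 0 (by omega)
    · refine Fin.lastCases ?_ (fun i => ?_) i
      · simpa using hy (k + 1) le_rfl
      · simpa using hw i
  · rw [Fin.sum_univ_succ, Fin.sum_univ_succ (fun i : Fin (k + 2) => y i ^ j),
      Fin.sum_univ_castSucc, Fin.sum_univ_castSucc (fun i : Fin (k + 1) => y i.succ ^ j)]
    simp only [Fin.cons_zero, Fin.cons_succ, Fin.snoc_castSucc, Fin.snoc_last, Fin.val_zero,
      Fin.val_succ, Fin.val_castSucc, Fin.val_last, h j h1 h2]
    ring

/-! ### Truncated atoms and separation of quantiles -/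

/-- Each excess is at most the mass of its atom, and distinct atoms are disjoint. This makes the
measure subtraction in `truncateAtoms` a genuine difference. -/
theorem atomExcess_le (σ : Measure ℝ) (ε : ℝ) :
    Measure.sum (fun x : {x : ℝ // ENNReal.ofReal ε < σ {x}} =>
      (σ {(x : ℝ)} - ENNReal.ofReal ε) • Measure.dirac (x : ℝ)) ≤ σ := by
  refine Measure.le_iff.2 fun s hs => ?_
  rw [Measure.sum_apply _ hs]
  calc _ ≤ ∑' x : {x : ℝ // ENNReal.ofReal ε < σ {x}}, σ ({(x : ℝ)} ∩ s) := by
        refine ENNReal.tsum_le_tsum fun x => ?_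
        rw [Measure.smul_apply, Measure.dirac_apply' _ hs, smul_eq_mul]
        by_cases hx : (x : ℝ) ∈ s
        · rw [indicator_of_mem hx, inter_eq_self_of_subset_left (singleton_subset_iff.2 hx)]
          simp
        · simp [indicator_of_notMem hx]
    _ ≤ σ (⋃ x : {x : ℝ // ENNReal.ofReal ε < σ {x}}, {(x : ℝ)} ∩ s) := by
        refine tsum_meas_le_meas_iUnion_of_disjoint σ
          (fun x => (measurableSet_singleton _).inter hs) fun x y hxy => ?_
        refine Disjoint.mono inter_subset_left inter_subset_left ?_
        rw [disjoint_singleton]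
        exact fun h => hxy (Subtype.ext h)
    _ ≤ σ s := measure_mono (iUnion_subset fun x => inter_subset_right)

theorem atomExcess_singleton (σ : Measure ℝ) (ε : ℝ) {x : ℝ} (hx : ENNReal.ofReal ε < σ {x}) :
    Measure.sum (fun x : {x : ℝ // ENNReal.ofReal ε < σ {x}} =>
      (σ {(x : ℝ)} - ENNReal.ofReal ε) • Measure.dirac (x : ℝ)) {x} =
      σ {x} - ENNReal.ofReal ε := by
  rw [Measure.sum_apply _ (measurableSet_singleton x), tsum_eq_single ⟨x, hx⟩]
  · simp
  · intro y hy
    have : (y : ℝ) ≠ x := fun h => hy (Subtype.ext h)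
    simp [this]

theorem truncateAtoms_le (σ : Measure ℝ) (ε : ℝ) : truncateAtoms σ ε ≤ σ := Measure.sub_le

theorem truncateAtoms_singleton (σ : Measure ℝ) [IsFiniteMeasure σ] (ε : ℝ) {x : ℝ}
    (hx : ENNReal.ofReal ε < σ {x}) : truncateAtoms σ ε {x} = ENNReal.ofReal ε := by
  have hle := atomExcess_le σ ε
  have : IsFiniteMeasure (Measure.sum (fun x : {x : ℝ // ENNReal.ofReal ε < σ {x}} =>
      (σ {(x : ℝ)} - ENNReal.ofReal ε) • Measure.dirac (x : ℝ))) := isFiniteMeasure_of_le _ hle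
  rw [truncateAtoms, Measure.sub_apply (measurableSet_singleton x) hle, atomExcess_singleton σ ε hx]
  exact ENNReal.sub_sub_cancel (measure_ne_top _ _) hx.le

theorem truncateAtoms_singleton_le (σ : Measure ℝ) [IsFiniteMeasure σ] (ε : ℝ) (x : ℝ) :
    truncateAtoms σ ε {x} ≤ ENNReal.ofReal ε := by
  rcases lt_or_ge (ENNReal.ofReal ε) (σ {x}) with hx | hx
  · exact (truncateAtoms_singleton σ ε hx).le
  · exact (truncateAtoms_le σ ε _).trans hx

theorem truncateAtoms_univ_ne_zero (σ : Measure ℝ) [IsProbabilityMeasure σ] {ε : ℝ} (hε : 0 < ε) :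
    truncateAtoms σ ε univ ≠ 0 := by
  by_cases h : ∃ x, ENNReal.ofReal ε < σ {x}
  · obtain ⟨x, hx⟩ := h
    intro h0
    have := measure_mono_null (subset_univ {x}) h0
    rw [truncateAtoms_singleton σ ε hx] at this
    simp only [ENNReal.ofReal_eq_zero] at this
    linarith
  · have : IsEmpty {x : ℝ // ENNReal.ofReal ε < σ {x}} := ⟨fun x => h ⟨x, x.2⟩⟩
    rw [truncateAtoms, Measure.sum_of_isEmpty, Measure.sub_zero, measure_univ]
    exact one_ne_zero

/-- Equally many indices apart, the quantile points of a multiple of `τ` are apart by the inverse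
modulus of the normalization of `τ`. -/
theorem inverseModulus_le_quantilePoint_sub {τ : Measure ℝ} [IsFiniteMeasure τ] (hτ0 : τ univ ≠ 0)
    (h01 : τ (Icc (0 : ℝ) 1)ᶜ = 0) {δ : ℝ} (hδ0 : 0 < δ) (hδ1 : δ < 1) {N i j : ℕ}
    (hij : i ≤ j) (hj : j < N) (hd : δ * N ≤ (j : ℝ) - i) :
    inverseModulus ((τ univ)⁻¹ • τ) δ ≤
      quantilePoint (ENNReal.ofReal (N / τ.real univ) • τ) j -
      quantilePoint (ENNReal.ofReal (N / τ.real univ) • τ) i := by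
  have hT : 0 < τ.real univ := ENNReal.toReal_pos hτ0 (measure_ne_top _ _)
  set c := ENNReal.ofReal (N / τ.real univ) with hc
  have hcfin : IsFiniteMeasure (c • τ) := τ.smul_finite ENNReal.ofReal_ne_top
  have hcr : c.toReal = N / τ.real univ := ENNReal.toReal_ofReal (by positivity)
  have hN : (c • τ).real univ = N := by
    rw [measureReal_ennreal_smul_apply, hcr]
    field_simp
  have hc01 : (c • τ) (Icc (0 : ℝ) 1)ᶜ = 0 := by simp [h01]
  have : IsProbabilityMeasure ((τ univ)⁻¹ • τ) := by
    constructor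
    rw [Measure.smul_apply, smul_eq_mul, ENNReal.inv_mul_cancel hτ0 (measure_ne_top _ _)]
  have h1 := sub_le_real_Icc_quantilePoint hc01 hN (hij.trans_lt hj) hj
  have h2 := quantilePoint_mono hc01 hN hij hj
  rw [← abs_of_nonneg (sub_nonneg.2 h2), abs_sub_comm]
  refine (inverseModulus_isLeast _ δ hδ0 hδ1).2 ⟨_, _, ?_, rfl⟩
  rw [ENNReal.ofReal_le_iff_le_toReal (measure_ne_top _ _), ← Measure.real,
    measureReal_ennreal_smul_apply, ENNReal.toReal_inv]
  rw [measureReal_ennreal_smul_apply, hcr] at h1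
  have hNpos : (0 : ℝ) < N := by exact_mod_cast (Nat.zero_le j).trans_lt hj
  have h3 := hd.trans h1
  have h4 : (N : ℝ) / τ.real univ * τ.real (Icc (quantilePoint (c • τ) i) (quantilePoint (c • τ) j))
    = ((τ univ).toReal⁻¹ * τ.real (Icc (quantilePoint (c • τ) i) (quantilePoint (c • τ) j))) * N := by
    rw [Measure.real]; ring
  rw [h4] at h3
  exact le_of_mul_le_mul_right h3 hNpos

theorem inverseModulus_pos {μ : Measure ℝ} [IsProbabilityMeasure μ] {δ : ℝ} (hδ0 : 0 < δ)
    (hδ1 : δ < 1) (hatom : ∀ x, μ {x} < ENNReal.ofReal δ) : 0 < inverseModulus μ δ := by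
  obtain ⟨x, y, hxy, h⟩ := (inverseModulus_isLeast μ δ hδ0 hδ1).1
  rw [h, abs_pos, sub_ne_zero]
  rintro rfl
  rw [Icc_self] at hxy
  exact absurd (hatom x) (not_lt.2 hxy)

theorem mem_Icc_quantilePoint_smul {τ : Measure ℝ} [IsFiniteMeasure τ] (hτ0 : τ univ ≠ 0)
    (h01 : τ (Icc (0 : ℝ) 1)ᶜ = 0) {N i : ℕ} (hi : i < N) :
    quantilePoint (ENNReal.ofReal (N / τ.real univ) • τ) i ∈ Icc (0 : ℝ) 1 := by
  have hT : 0 < τ.real univ := ENNReal.toReal_pos hτ0 (measure_ne_top _ _)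
  have := τ.smul_finite (c := ENNReal.ofReal (N / τ.real univ)) ENNReal.ofReal_ne_top
  refine quantilePoint_mem_Icc (N := N) (by simp [h01]) ?_ hi
  rw [measureReal_ennreal_smul_apply, ENNReal.toReal_ofReal (by positivity)]
  field_simp

/-! ### Correcting the moments -/

/-- The quantile points can be moved so as to correct the moments. -/
theorem exists_sum_pow_eq_add {q : ℕ → ℝ} {k M : ℕ} (hM : 0 < M) {R η : ℝ} (hR : 0 < R)
    (hq : ∀ i < (k + 2) * M, q i ∈ Icc (0 : ℝ) 1)
    (hgap : ∀ i, i + M < (k + 2) * M → R ≤ q (i + M) - q i)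
    {E : ℕ → ℝ} (hη1 : η ≤ 1) (hE : ∀ j, 1 ≤ j → |E j| ≤ M * η)
    (hη : η * (k * 2 ^ (k - 1)) < R ^ k * k.factorial / 4 ^ k) (hη0 : 0 ≤ η) :
    ∃ w : Fin M × Fin (k + 2) → ℝ, (∀ i, w i ∈ Icc (0 : ℝ) 1) ∧ ∀ j : ℕ, 1 ≤ j → j ≤ k →
      ∑ i, w i ^ j = ∑ i ∈ Finset.range ((k + 2) * M), q i ^ j + E j := by
  have hM' : (0 : ℝ) < M := by exact_mod_cast hM
  have hidx : ∀ (g : Fin M) (s : ℕ), s ≤ k + 1 → (g : ℕ) + M * s < (k + 2) * M := by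
    intro g s hs
    have := Nat.mul_le_mul_left M hs
    have := g.2
    nlinarith
  have hgroup : ∀ g : Fin M, ∃ w : Fin (k + 2) → ℝ, (∀ i, w i ∈ Icc (0 : ℝ) 1) ∧
      ∀ j : ℕ, 1 ≤ j → j ≤ k → ∑ i, w i ^ j = ∑ i : Fin (k + 2), q (g + M * i) ^ j +
        (if j = 0 then 0 else E j / M) := by
    intro g
    refine exists_powerSum_eq_add' (y := fun s => q (g + M * s)) hR
      (fun s hs => hq _ (hidx g s hs)) (fun s hs => ?_)
      (D := fun j => if j = 0 then 0 else E j / M) (by simp) hη1 (fun j => ?_) hη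
    · have h := hidx g (s + 1) (by omega)
      rw [mul_add, mul_one, ← add_assoc] at h
      have := hgap _ h
      rwa [mul_add, mul_one, ← add_assoc]
    · split_ifs with h
      · simpa using hη0
      · rw [abs_div, abs_of_pos hM', div_le_iff₀ hM', mul_comm]
        exact hE j (by omega)
  choose w hw hsum using hgroup
  refine ⟨fun p => w p.1 p.2, fun p => hw _ _, fun j h1 h2 => ?_⟩
  rw [Fintype.sum_prod_type]
  simp only
  rw [Finset.sum_congr rfl fun g _ => hsum g j h1 h2, Finset.sum_add_distrib]
  congr 1
  -- `finProdFinEquiv` sends `(s, g)` to `g + M * s`, which is the grouping by residue modulo `M`.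
  · rw [← Fin.sum_univ_eq_sum_range (fun i => q i ^ j), ← finProdFinEquiv.sum_comp,
      Fintype.sum_prod_type, Finset.sum_comm]
    rfl
  · rw [if_neg (by omega)]
    simp
    field_simp

/-- If the mass `N` of `c • τ` is an integer, then `n • σ` splits into `c • τ` and a measure of
integral mass, and each part is replaced by its quantile points. -/
theorem exists_quantile_approx {σ τ : Measure ℝ} [IsProbabilityMeasure σ]
    (hσ : σ (Icc (0 : ℝ) 1)ᶜ = 0) (hτσ : τ ≤ σ) (hτ0 : τ univ ≠ 0) {n N : ℕ}
    (hN : (N : ℝ) ≤ n * τ.real univ) :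
    ∃ u : Fin (n - N) → ℝ, (∀ i, u i ∈ Icc (0 : ℝ) 1) ∧ ∀ j : ℕ, 1 ≤ j →
      |n * ∫ t, t ^ j ∂σ - (∑ i ∈ Finset.range N,
        quantilePoint (ENNReal.ofReal (N / τ.real univ) • τ) i ^ j + ∑ i, u i ^ j)| ≤ 2 := by
  have hτfin : IsFiniteMeasure τ := isFiniteMeasure_of_le σ hτσ
  have hT : 0 < τ.real univ := ENNReal.toReal_pos hτ0 (measure_ne_top _ _)
  have hT1 : τ.real univ ≤ 1 := by
    have := ENNReal.toReal_mono (measure_ne_top σ univ) (hτσ univ)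
    simpa [Measure.real] using this
  have hτ01 : τ (Icc (0 : ℝ) 1)ᶜ = 0 := le_antisymm ((hτσ _).trans hσ.le) zero_le
  set c := ENNReal.ofReal (N / τ.real univ) with hc
  have hcr : c.toReal = N / τ.real univ := ENNReal.toReal_ofReal (by positivity)
  have hαfin : IsFiniteMeasure (c • τ) := τ.smul_finite ENNReal.ofReal_ne_top
  have hnfin : IsFiniteMeasure ((n : ENNReal) • σ) := σ.smul_finite (ENNReal.natCast_ne_top n)
  have hcn : c ≤ n := by
    rw [hc, ← ENNReal.ofReal_natCast]
    exact ENNReal.ofReal_le_ofReal ((div_le_iff₀ hT).2 hN)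
  have hle : c • τ ≤ (n : ENNReal) • σ := by
    intro s
    rw [Measure.smul_apply, Measure.smul_apply, smul_eq_mul, smul_eq_mul]
    exact mul_le_mul' hcn (hτσ s)
  set β := (n : ENNReal) • σ - c • τ with hβ
  have hadd : β + c • τ = (n : ENNReal) • σ := Measure.sub_add_cancel_of_le hle
  have hβle : β ≤ (n : ENNReal) • σ := Measure.sub_le
  have hβfin : IsFiniteMeasure β := isFiniteMeasure_of_le _ hβle
  have hαN : (c • τ).real univ = N := by
    rw [measureReal_ennreal_smul_apply, hcr]
    field_simp
  have hNn : N ≤ n := by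
    have : (N : ℝ) ≤ n := hN.trans (mul_le_of_le_one_right (by positivity) hT1)
    exact_mod_cast this
  have hβN : β.real univ = ((n - N : ℕ) : ℝ) := by
    have h : (β + c • τ).real univ = n := by
      rw [hadd, measureReal_ennreal_smul_apply]
      simp
    rw [measureReal_add_apply, hαN] at h
    rw [Nat.cast_sub hNn]
    linarith
  have hα01 : (c • τ) (Icc (0 : ℝ) 1)ᶜ = 0 := by simp [hτ01]
  have hβ01 : β (Icc (0 : ℝ) 1)ᶜ = 0 :=
    le_antisymm ((hβle _).trans (by simp [hσ])) zero_le
  refine ⟨fun i => quantilePoint β i, fun i => quantilePoint_mem_Icc hβ01 hβN i.2, fun j hj => ?_⟩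
  have hint : ∀ μ : Measure ℝ, IsFiniteMeasure μ → μ (Icc (0 : ℝ) 1)ᶜ = 0 →
      Integrable (fun t : ℝ => t ^ j) μ := by
    intro μ _ h
    have hae : ∀ᵐ t ∂μ, t ∈ Icc (0 : ℝ) 1 := h
    refine Integrable.of_bound (by fun_prop) 1 ?_
    filter_upwards [hae] with t ht
    rw [Real.norm_eq_abs, abs_pow, abs_of_nonneg ht.1]
    exact pow_le_one₀ ht.1 ht.2
  have hsplit : n * ∫ t, t ^ j ∂σ = ∫ t, t ^ j ∂β + ∫ t, t ^ j ∂(c • τ) := by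
    rw [← integral_add_measure (hint β hβfin hβ01) (hint _ hαfin hα01), hadd, integral_smul_measure]
    simp
  have h1 := abs_sum_quantilePoint_pow_sub_le hα01 hαN (j := j) (by omega)
  have h2 := abs_sum_quantilePoint_pow_sub_le hβ01 hβN (j := j) (by omega)
  rw [hsplit, Fin.sum_univ_eq_sum_range (fun i => quantilePoint β i ^ j)]
  rw [abs_le] at h1 h2 ⊢
  constructor <;> linarith [h1.1, h1.2, h2.1, h2.2]

theorem theorem1p5 (σ : Measure ℝ) [IsProbabilityMeasure σ] (hσ : σ (Icc (0 : ℝ) 1) = 1)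
    (k : ℕ) (hk : 2 ≤ k) (ε : ℝ) (hε0 : 0 < ε) (hε1 : ε < 1)
    (hε : ε / (truncateAtoms σ ε).real (Icc (0 : ℝ) 1) < 2 / (2 * (k : ℝ) + 7))
    (ρ r : ℝ)
    (hρ : ρ = ((k : ℝ) - 1) *
      inverseModulus (normalizedTruncation σ ε) (2 / (2 * (k : ℝ) + 7)))
    (hr : r = ρ / (6 * ((k : ℝ) + 3)) * (ρ / (12 * Real.exp 1)) ^ (k - 1))
    (n : ℕ)
    (hn : max (1 / (r * (truncateAtoms σ ε).real (Icc (0 : ℝ) 1)))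
      ((2 * (k : ℝ) + 6) / ε) ≤ (n : ℝ)) :
    ∃ x : Fin n → ℝ, (∀ i, x i ∈ Icc (0 : ℝ) 1) ∧
      ∀ j : ℕ, 1 ≤ j → j ≤ k →
        (1 / (n : ℝ)) * ∑ i, x i ^ j = ∫ t, t ^ j ∂σ := by
  have hk' : (2 : ℝ) ≤ k := by exact_mod_cast hk
  have hσ01 : σ (Icc (0 : ℝ) 1)ᶜ = 0 := (prob_compl_eq_zero_iff measurableSet_Icc).2 hσ
  have hτσ : truncateAtoms σ ε ≤ σ := truncateAtoms_le σ ε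
  have hτ0 := truncateAtoms_univ_ne_zero σ hε0
  have hatom := truncateAtoms_singleton_le σ ε
  rw [normalizedTruncation] at hρ
  set τ := truncateAtoms σ ε
  have hτfin : IsFiniteMeasure τ := isFiniteMeasure_of_le σ hτσ
  have hT : 0 < τ.real univ := ENNReal.toReal_pos hτ0 (measure_ne_top _ _)
  have hτ01 : τ (Icc (0 : ℝ) 1)ᶜ = 0 := le_antisymm ((hτσ _).trans hσ01.le) zero_le
  have hTeq : τ.real (Icc (0 : ℝ) 1) = τ.real univ := by
    have h := measureReal_add_measureReal_compl (μ := τ) (measurableSet_Icc (a := (0 : ℝ)) (b := 1))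
    have h0 : τ.real (Icc (0 : ℝ) 1)ᶜ = 0 := by rw [Measure.real, hτ01, ENNReal.toReal_zero]
    rw [h0, add_zero] at h
    exact h
  rw [hTeq] at hε hn
  set T := τ.real univ with hTdef
  have hprob : IsProbabilityMeasure ((τ univ)⁻¹ • τ) := by
    constructor
    rw [Measure.smul_apply, smul_eq_mul, ENNReal.inv_mul_cancel hτ0 (measure_ne_top _ _)]
  set δ : ℝ := 2 / (2 * (k : ℝ) + 7) with hδ
  have hδ0 : 0 < δ := by positivity
  have hδ1 : δ < 1 := by rw [hδ, div_lt_one (by positivity)]; linarith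
  have hδk : δ * ((k : ℝ) + 2) ≤ 1 := by
    rw [hδ, div_mul_eq_mul_div, div_le_one (by positivity)]; linarith
  set R := inverseModulus ((τ univ)⁻¹ • τ) δ with hRdef
  -- Atoms of the normalized truncation have mass at most `ε / T < δ`, so no degenerate interval
  -- reaches mass `δ`.
  have hR : 0 < R := by
    refine inverseModulus_pos hδ0 hδ1 fun x => ?_
    rw [ENNReal.lt_ofReal_iff_toReal_lt (measure_ne_top _ _)]
    refine lt_of_le_of_lt ?_ hε
    rw [Measure.smul_apply, smul_eq_mul, ENNReal.toReal_mul, ENNReal.toReal_inv, div_eq_inv_mul]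
    refine mul_le_mul_of_nonneg_left ?_ (by positivity)
    exact ENNReal.toReal_le_of_le_ofReal hε0.le (hatom x)
  have hsep : ∀ {M i : ℕ}, i + M < (k + 2) * M →
      R ≤ quantilePoint (ENNReal.ofReal (((k + 2) * M : ℕ) / τ.real univ) • τ) (i + M) -
        quantilePoint (ENNReal.ofReal (((k + 2) * M : ℕ) / τ.real univ) • τ) i := by
    intro M i h
    refine inverseModulus_le_quantilePoint_sub hτ0 hτ01 hδ0 hδ1 (Nat.le_add_right i M) h ?_
    push_cast
    have : (0 : ℝ) ≤ M := by positivity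
    nlinarith
  -- The case `M = 1` of `hsep`: `k + 2` quantile points with gaps `R` fit into the unit interval.
  -- Hence `ρ ≤ 1`.
  have hR1 : ((k : ℝ) + 1) * R ≤ 1 := by
    have h := mul_le_sub_of_gap (k := k) (fun s hs => hsep (M := 1) (i := s) (by omega))
      (Nat.zero_le (k + 1)) le_rfl
    have h0 := mem_Icc_quantilePoint_smul hτ0 hτ01 (N := (k + 2) * 1) (i := 0) (by omega)
    have h1 := mem_Icc_quantilePoint_smul hτ0 hτ01 (N := (k + 2) * 1) (i := k + 1) (by omega)
    push_cast at h h0 h1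
    linarith [h0.1, h1.2]
  have hρ0 : 0 < ρ := by rw [hρ]; exact mul_pos (by linarith) hR
  have hρ1 : ρ ≤ 1 := by rw [hρ]; nlinarith
  have he := Real.exp_one_gt_d9
  have hbase : ρ / (12 * Real.exp 1) ≤ 1 / 2 := by
    rw [div_le_div_iff₀ (by positivity) (by norm_num)]; linarith
  have hr0 : 0 < r := by rw [hr]; positivity
  have hpow : (ρ / (12 * Real.exp 1)) ^ (k - 1) ≤ (1 / 2) ^ (k - 1) := by gcongr
  have hrk : r * (((k : ℝ) + 2) * (k + 3)) ≤ 1 := by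
    have h2k : ((k : ℝ) + 2) * (1 / 2) ^ (k - 1) ≤ 6 := by
      obtain ⟨m, rfl⟩ := Nat.exists_eq_add_of_le' (show 1 ≤ k by omega)
      have : ((m : ℝ) + 1) ≤ 2 ^ m := by exact_mod_cast Nat.lt_two_pow_self
      rw [Nat.add_sub_cancel, one_div, inv_pow, ← div_eq_mul_inv, div_le_iff₀ (by positivity)]
      push_cast
      nlinarith
    calc r * (((k : ℝ) + 2) * (k + 3))
        = ρ / 6 * (((k : ℝ) + 2) * (ρ / (12 * Real.exp 1)) ^ (k - 1)) := by
          rw [hr]; field_simp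
      _ ≤ 1 / 6 * (((k : ℝ) + 2) * (1 / 2) ^ (k - 1)) := by gcongr
      _ ≤ 1 := by linarith
  have hnT : 1 ≤ r * (n * T) := by
    have h := (le_max_left _ _).trans hn
    rw [div_le_iff₀ (by positivity)] at h
    linarith
  have hnTk : ((k : ℝ) + 2) * (k + 3) ≤ n * T :=
    le_of_mul_le_mul_left (hrk.trans hnT) hr0
  have hn0 : (0 : ℝ) < n := by
    rcases Nat.eq_zero_or_pos n with h | h
    · rw [h] at hnT; norm_num at hnT
    · exact_mod_cast h
  set M := ⌊(n : ℝ) * T / (k + 2)⌋₊ with hMdef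
  have hMle : ((k : ℝ) + 2) * M ≤ n * T := by
    have h := Nat.floor_le (show 0 ≤ (n : ℝ) * T / (k + 2) by positivity)
    rw [le_div_iff₀ (by positivity)] at h
    linarith
  -- Since `n * T ≥ (k + 2) * (k + 3)`, the floor `M` is at least `k + 2`, so `(k + 2) * (M + 1) ≤
  -- (k + 3) * M`.
  have hMge : (n : ℝ) * T ≤ (k + 3) * M := by
    have h := (Nat.lt_floor_add_one ((n : ℝ) * T / (k + 2))).le
    rw [div_le_iff₀ (by positivity), ← hMdef] at h
    have hM3 : (k : ℝ) + 2 ≤ M := by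
      by_contra hcon
      have h5 : (M : ℝ) + 1 ≤ k + 2 := by exact_mod_cast (by exact_mod_cast not_le.1 hcon : M < k + 2)
      nlinarith
    nlinarith
  have hM0 : 0 < M := by
    rcases Nat.eq_zero_or_pos M with h | h
    · rw [h] at hMge; push_cast at hMge; nlinarith
    · exact h
  set η := ρ / 3 * (ρ / (12 * Real.exp 1)) ^ (k - 1) with hη
  have hηr : η = 2 * (k + 3) * r := by rw [hη, hr]; field_simp; ring
  have hη0 : 0 ≤ η := by positivity
  have hη1 : η ≤ 1 := by
    have : (1 / 2 : ℝ) ^ (k - 1) ≤ 1 := pow_le_one₀ (by norm_num) (by norm_num)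
    have h : (ρ / (12 * Real.exp 1)) ^ (k - 1) ≤ 1 := hpow.trans this
    calc η ≤ 1 / 3 * 1 := by rw [hη]; gcongr
      _ ≤ 1 := by norm_num
  -- `η = 2 * (k + 3) * r` is chosen for this: `M * η ≥ 2 * r * n * T ≥ 2`, so the `M` groups
  -- together absorb the quantile error.
  have hMη : 2 ≤ M * η := by
    rw [hηr]
    have := mul_le_mul_of_nonneg_left hMge hr0.le
    nlinarith
  obtain ⟨u, hu, hsum⟩ := exists_quantile_approx hσ01 hτσ hτ0 (n := n) (N := (k + 2) * M)
    (by push_cast; exact hMle)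
  obtain ⟨w, hw, hwsum⟩ := exists_sum_pow_eq_add hM0 hR
    (fun i hi => mem_Icc_quantilePoint_smul hτ0 hτ01 hi) (fun i hi => hsep hi) hη1
    (fun j hj => (hsum j hj).trans hMη) (shift_lt_midpoint_bound hk hR hρ) hη0
  have hNn : (k + 2) * M ≤ n := by
    have hT1 : T ≤ 1 := by
      have := ENNReal.toReal_mono (measure_ne_top σ univ) (hτσ univ)
      simpa [hTdef, Measure.real] using this
    have : (((k + 2) * M : ℕ) : ℝ) ≤ n := by
      push_cast
      exact hMle.trans (mul_le_of_le_one_right hn0.le hT1)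
    exact_mod_cast this
  have hcard : Fintype.card (Fin n) = Fintype.card (Fin (n - (k + 2) * M) ⊕ Fin M × Fin (k + 2)) := by
    simp only [Fintype.card_sum, Fintype.card_prod, Fintype.card_fin]
    rw [mul_comm M]
    omega
  let e := Fintype.equivOfCardEq hcard
  refine ⟨fun i => Sum.elim u w (e i), fun i => ?_, fun j h1 h2 => ?_⟩
  · exact (e i).casesOn (motive := fun p => Sum.elim u w p ∈ Icc (0 : ℝ) 1) hu hw
  · rw [e.sum_comp (fun i => Sum.elim u w i ^ j), Fintype.sum_sum_type]
    simp only [Sum.elim_inl, Sum.elim_inr]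
    rw [hwsum j h1 h2]
    field_simp
    ring
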